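/- Let $\mathcal S_+^{\rm mon}$ denote the set of Schwartz functions $\rho:\mathbb R\to\mathbb R$ with $\rho>0$ everywhere for which there is $K>0$ with $x\rho'(x)\le 0$ whenever $|x|>K$. Let $c>0$ be fixed and $\phi(\theta)=-c\cot(\theta/2)$ for $\theta\in(0,2\pi)$. For $\rho\in\mathcal S_+^{\rm mon}$, $1<q<\infty$ and an integer $\alpha\ge1$, let $W^{\alpha,q}_\rho(\mathbb R)$ be the space of measurable $f:\mathbb R\to\mathbb C$ whose weak derivatives $f^{(\tau)}$, $0\le\tau\le\alpha$, exist and satisfy $$\|f\|_{W^{\alpha,q}_\rho(\mathbb R)}=\Big(\sum_{\tau=0}^{\alpha}\int_{\mathbb R}|f^{(\tau)}(x)|^q\rho(x)\,dx\Big)^{1/q}<\infty .$$ Let $W^{\alpha,q}_{\rm per}(0,2\pi)$ be the space of those $g$ in the unweighted Sobolev space $W^{\alpha,q}(0,2\pi)$ (complex-valued, with weak derivatives on the open interval $(0,2\pi)$) such that, for $\tau=0,\dots,\alpha-1$, the representative of $g^{(\tau)}$ that is continuous on $[0,2\pi]$ satisfies $g^{(\tau)}(0)=g^{(\tau)}(2\pi)$.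 \textbf{Lemma.} Let $\rho\in\mathcal S_+^{\rm mon}$, $1\le p<q<\infty$ and $c>0$. For every integer $\tau\ge0$ there is a constant $C=C_{\rho,\tau,p,q,c}>0$ such that the following holds. Let $\alpha\ge1$ be an integer, $f\in W^{\alpha,q}_\rho(\mathbb R)$, and $$g_p=\big((f\rho^{1/p})\circ\phi\big)\,(\phi')^{1/p}\quad\text{on }(0,2\pi).$$ For $\tau=0,\dots,\alpha$ the weak derivative $g_p^{(\tau)}$ on $(0,2\pi)$ exists, belongs to $L^q(0,2\pi)$, and $$\|g_p^{(\tau)}\|_{L^q(0,2\pi)}\le C_{\rho,\tau,p,q,c}\,\|f\|_{W^{\alpha,q}_\rho(\mathbb R)} .$$ Moreover, for $\tau=0,\dots,\alpha-1$ the weak derivative $g_p^{(\tau)}$ has a representative that is continuous on $(0,2\pi)$, and this representative satisfies $$\lim_{\theta\to0^+}g_p^{(\tau)}(\theta)=\lim_{\theta\to2\pi^-}g_p^{(\tau)}(\theta)=0 .$$ In consequence, $g_p\in W^{\alpha,q}_{\rm per}(0,2\pi)$. -/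

import Mathlib

open MeasureTheory Set Filter Topology
open scoped SchwartzMap ContDiff

namespace MoebiusSobolev

/-- A real Schwartz function is a monotonic Schwartz weight if it is positive and, outside some
interval `[-K, K]`, it is monotonically decaying in the sense that `x * ρ'(x) ≤ 0`. -/
def IsMonotonicWeight (ρ : 𝓢(ℝ, ℝ)) : Prop :=
  (∀ x, 0 < ρ x) ∧ ∃ K : ℝ, 0 < K ∧ ∀ x, x ∉ Icc (-K) K → x * deriv (fun y => ρ y) x ≤ 0

/-- The Möbius change of variables `φ_c(θ) = -c cot(θ/2)` from `(0, 2π)` onto `ℝ`. -/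
noncomputable def phi (c θ : ℝ) : ℝ := -c * Real.cot (θ / 2)

/-- The transformed function `g_p = ((f ρ^{1/p}) ∘ φ_c) (φ_c')^{1/p}`. -/
noncomputable def gTrans (c p : ℝ) (ρ : ℝ → ℝ) (f : ℝ → ℂ) (θ : ℝ) : ℂ :=
  f (phi c θ) * ((ρ (phi c θ) ^ (1 / p) : ℝ) : ℂ) * ((deriv (phi c) θ ^ (1 / p) : ℝ) : ℂ)

/-- `h` is a weak derivative of order `τ` of `f` on the open set `U ⊆ ℝ`, with `C_c^∞(U)` as the
space of test functions. -/
def IsWeakDeriv (U : Set ℝ) (τ : ℕ) (f h : ℝ → ℂ) : Prop :=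
  LocallyIntegrableOn f U ∧ LocallyIntegrableOn h U ∧
    ∀ ψ : ℝ → ℝ, ContDiff ℝ ∞ ψ → HasCompactSupport ψ → tsupport ψ ⊆ U →
      ∫ x in U, ψ x • h x = (-1 : ℂ) ^ τ * ∫ x in U, iteratedDeriv τ ψ x • f x

open Classical in
/-- The weak derivative of order `τ` of `f` on `U` (determined almost everywhere on `U`); by
convention it is `0` if there is no weak derivative of that order. -/
noncomputable def weakDeriv (U : Set ℝ) (τ : ℕ) (f : ℝ → ℂ) : ℝ → ℂ :=
  if H : ∃ h, IsWeakDeriv U τ f h then H.choose else 0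

/-- Membership of `f` in the space `L^q` on `U` with respect to the weight `w`. -/
def MemLq (U : Set ℝ) (w : ℝ → ℝ) (q : ℝ) (f : ℝ → ℂ) : Prop :=
  AEStronglyMeasurable f (volume.restrict U) ∧ IntegrableOn (fun x => ‖f x‖ ^ q * w x) U

/-- The weighted norm `(∫_U |f|^q w dx)^{1/q}`. -/
noncomputable def lqNorm (U : Set ℝ) (w : ℝ → ℝ) (q : ℝ) (f : ℝ → ℂ) : ℝ :=
  (∫ x in U, ‖f x‖ ^ q * w x) ^ (1 / q)

/-- Membership in the weighted Sobolev space `W^{α,q}_w(U)`: `f` and all its weak derivatives up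
to order `α` exist and belong to the weighted `L^q` space. -/
def MemSobolev (U : Set ℝ) (w : ℝ → ℝ) (α : ℕ) (q : ℝ) (f : ℝ → ℂ) : Prop :=
  MemLq U w q f ∧ ∀ τ ≤ α, ∃ h, IsWeakDeriv U τ f h ∧ MemLq U w q h

/-- The norm `(∑_{τ ≤ α} ∫_U |f^{(τ)}|^q w dx)^{1/q}` of the weighted Sobolev space. -/
noncomputable def sobolevNorm (U : Set ℝ) (w : ℝ → ℝ) (α : ℕ) (q : ℝ) (f : ℝ → ℂ) : ℝ :=
  (∑ τ ∈ Finset.range (α + 1), ∫ x in U, ‖weakDeriv U τ f x‖ ^ q * w x) ^ (1 / q)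

/-- Membership in `W^{α,q}_per(0, 2π)`: `f` belongs to the unweighted space `W^{α,q}(0, 2π)`, and
for every `τ < α` the representative of `f^{(τ)}` that is continuous on `[0, 2π]` takes the same
value at `0` and `2π`. -/
def MemSobolevPer (α : ℕ) (q : ℝ) (f : ℝ → ℂ) : Prop :=
  MemSobolev (Ioo 0 (2 * Real.pi)) (fun _ => 1) α q f ∧
    ∀ τ < α, ∃ h, IsWeakDeriv (Ioo 0 (2 * Real.pi)) τ f h ∧
      ContinuousOn h (Icc 0 (2 * Real.pi)) ∧ h 0 = h (2 * Real.pi)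

end MoebiusSobolev

/-! Put `x = φ(θ)`. Then `φ'` is the polynomial `m(x) = (c² + x²) / (2c)`, so differentiation in `θ`
becomes `m D` with `D = d/dx`, and `g_p^{(τ)}` is `(m D)^τ (w f)` read at `x = φ(θ)`, where `w = (ρ
m)^{1/p}`. Expanding gives a sum of terms `a_{τ,j} f^{(j)}` with `j ≤ τ` (`isWeakDeriv_transDeriv`).

The crux is that every coefficient satisfies `|a_{τ,j}| ≤ C ρ^s` for all `s < 1/p`, in particular
for `s = 1/q`. Powers of `m` cost only an arbitrarily small power of `ρ`, because `ρ` decays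
rapidly. What remains is to bound every derivative of `ρ` by `ρ^s` for each `s < 1`. On a monotone
tail a Landau inequality makes the best exponent a concave function of the order of the derivative.
That function is nonnegative, hence nondecreasing, and it is at least `1` at order `0`
(`derivDominated_of_lt_one`).

Raising to the power `q` gives `|g_p^{(τ)}|^q ≤ D ∑ |f^{(j)}|^q ρ`, integrable in `dx` over the
whole line (`exists_transform`). As `m ≥ c/2`, this controls the integral in `dθ`. It also gives the
boundary values: for `τ < α` the next derivative is integrable, so `g_p^{(τ)}` extends continuously
to `[0, 2π]`, and a nonzero endpoint value would contradict integrability in `dx` near `±∞`. -/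

namespace MoebiusSobolev

/-! ### Calculus of weak derivatives on an open set. -/

section WeakDerivatives

variable {U : Set ℝ} {τ : ℕ} {f g u v : ℝ → ℂ} {ψ : ℝ → ℝ}

lemma integrable_smul_of_tsupport_subset (hu : LocallyIntegrableOn u U) (hψ : Continuous ψ)
    (hc : HasCompactSupport ψ) (hs : tsupport ψ ⊆ U) : Integrable (fun x => ψ x • u x) := by
  have h : IntegrableOn (fun x => ψ x • u x) (tsupport ψ) :=
    (hu.integrableOn_compact_subset hs hc).continuousOn_smul hψ.continuousOn hc
  refine (integrableOn_iff_integrable_of_support_subset ?_).1 h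
  exact (Function.support_smul_subset_left _ _).trans (subset_tsupport ψ)

lemma setIntegral_smul_of_tsupport_subset (hs : tsupport ψ ⊆ U) (u : ℝ → ℂ) :
    ∫ x in U, ψ x • u x = ∫ x, ψ x • u x := by
  apply setIntegral_eq_integral_of_forall_compl_eq_zero
  intro x hx
  rw [image_eq_zero_of_notMem_tsupport (fun h => hx (hs h)), zero_smul]

lemma isWeakDeriv_one_iff :
    IsWeakDeriv U 1 u v ↔ LocallyIntegrableOn u U ∧ LocallyIntegrableOn v U ∧
      ∀ ψ : ℝ → ℝ, ContDiff ℝ ∞ ψ → HasCompactSupport ψ → tsupport ψ ⊆ U →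
        ∫ x in U, ψ x • v x = - ∫ x in U, deriv ψ x • u x := by
  simp [IsWeakDeriv, iteratedDeriv_one]

lemma isWeakDeriv_zero (hf : LocallyIntegrableOn f U) : IsWeakDeriv U 0 f f :=
  ⟨hf, hf, fun ψ _ _ _ => by simp⟩

lemma IsWeakDeriv.congr_ae {f' h h' : ℝ → ℂ} (H : IsWeakDeriv U τ f h)
    (hf : f =ᵐ[volume.restrict U] f') (hh : h =ᵐ[volume.restrict U] h') :
    IsWeakDeriv U τ f' h' := by
  refine ⟨H.1.congr hf, H.2.1.congr hh, fun ψ h1 h2 h3 => ?_⟩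
  have e1 : ∫ x in U, ψ x • h' x = ∫ x in U, ψ x • h x :=
    integral_congr_ae (hh.mono fun x hx => by simp only [hx])
  have e2 : ∫ x in U, iteratedDeriv τ ψ x • f' x = ∫ x in U, iteratedDeriv τ ψ x • f x :=
    integral_congr_ae (hf.mono fun x hx => by simp only [hx])
  rw [e1, e2, H.2.2 ψ h1 h2 h3]

lemma IsWeakDeriv.ae_eq {h h' : ℝ → ℂ} (hU : IsOpen U) (H : IsWeakDeriv U τ f h)
    (H' : IsWeakDeriv U τ f h') : h =ᵐ[volume.restrict U] h' := by
  have key : ∀ᵐ x, x ∈ U → (h - h') x = 0 := by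
    refine hU.ae_eq_zero_of_integral_contDiff_smul_eq_zero (H.2.1.sub H'.2.1) ?_
    intro ψ h1 h2 h3
    simp only [Pi.sub_apply, smul_sub]
    rw [integral_sub (integrable_smul_of_tsupport_subset H.2.1 h1.continuous h2 h3)
      (integrable_smul_of_tsupport_subset H'.2.1 h1.continuous h2 h3),
      ← setIntegral_smul_of_tsupport_subset h3, ← setIntegral_smul_of_tsupport_subset h3,
      H.2.2 ψ h1 h2 h3, H'.2.2 ψ h1 h2 h3, sub_self]
  rw [EventuallyEq, ae_restrict_iff' hU.measurableSet]
  filter_upwards [key] with x hx hxU using sub_eq_zero.1 (hx hxU)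

lemma isWeakDeriv_weakDeriv {h : ℝ → ℂ} (H : IsWeakDeriv U τ f h) :
    IsWeakDeriv U τ f (weakDeriv U τ f) := by
  have H' : ∃ h, IsWeakDeriv U τ f h := ⟨h, H⟩
  rw [weakDeriv, dif_pos H']
  exact H'.choose_spec

lemma IsWeakDeriv.trans_one (H : IsWeakDeriv U τ f u) (H' : IsWeakDeriv U 1 u v) :
    IsWeakDeriv U (τ + 1) f v := by
  rw [isWeakDeriv_one_iff] at H'
  refine ⟨H.1, H'.2.1, fun ψ h1 h2 h3 => ?_⟩
  rw [H'.2.2 ψ h1 h2 h3,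
    H.2.2 (deriv ψ) (by fun_prop) h2.deriv ((tsupport_deriv_subset).trans h3), iteratedDeriv_succ']
  ring

/-- The derivative of a test function is again a test function, so the order `τ` identity can be
applied to `deriv ψ`. This turns derivatives of `f` given separately for each order into a chain of
first-order ones, to which product and chain rules apply. -/
lemma IsWeakDeriv.one_of_succ (H : IsWeakDeriv U τ f u) (H' : IsWeakDeriv U (τ + 1) f v) :
    IsWeakDeriv U 1 u v := by
  rw [isWeakDeriv_one_iff]
  refine ⟨H.2.1, H'.2.1, fun ψ h1 h2 h3 => ?_⟩
  rw [H'.2.2 ψ h1 h2 h3,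
    H.2.2 (deriv ψ) (by fun_prop) h2.deriv ((tsupport_deriv_subset).trans h3), iteratedDeriv_succ']
  ring

lemma isWeakDeriv_one_sum {ι : Type*} (s : Finset ι) {u v : ι → ℝ → ℂ} (hU : IsOpen U)
    (H : ∀ i ∈ s, IsWeakDeriv U 1 (u i) (v i)) :
    IsWeakDeriv U 1 (fun x => ∑ i ∈ s, u i x) (fun x => ∑ i ∈ s, v i x) := by
  have hli : ∀ w : ι → ℝ → ℂ, (∀ i ∈ s, LocallyIntegrableOn (w i) U) →
      LocallyIntegrableOn (fun x => ∑ i ∈ s, w i x) U := by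
    intro w hw
    rw [locallyIntegrableOn_iff hU.isLocallyClosed]
    intro k hk hkc
    exact integrable_finsetSum _ fun i hi => (hw i hi).integrableOn_compact_subset hk hkc
  rw [isWeakDeriv_one_iff]
  refine ⟨hli u fun i hi => (H i hi).1, hli v fun i hi => (H i hi).2.1, fun ψ h1 h2 h3 => ?_⟩
  simp only [Finset.smul_sum]
  rw [integral_finsetSum, integral_finsetSum, ← Finset.sum_neg_distrib]
  · exact Finset.sum_congr rfl fun i hi => (isWeakDeriv_one_iff.1 (H i hi)).2.2 ψ h1 h2 h3
  · exact fun i hi => (integrable_smul_of_tsupport_subset (H i hi).1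
      (h1.continuous_deriv (by simp)) h2.deriv (tsupport_deriv_subset.trans h3)).restrict
  · exact fun i hi => (integrable_smul_of_tsupport_subset (H i hi).2.1
      h1.continuous h2 h3).restrict

/-- Product rule, obtained by testing against `ψ * a`; smoothness of `a` keeps this a test function.
-/
lemma IsWeakDeriv.smul_contDiff {a : ℝ → ℝ} (hU : IsOpen U) (H : IsWeakDeriv U 1 u v)
    (ha : ContDiff ℝ ∞ a) :
    IsWeakDeriv U 1 (fun x => a x • u x) (fun x => deriv a x • u x + a x • v x) := by
  rw [isWeakDeriv_one_iff] at H ⊢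
  obtain ⟨hu, hv, H⟩ := H
  have ha' : Continuous (deriv a) := ha.continuous_deriv (by simp)
  have h1 := hu.continuousOn_smul hU.isLocallyClosed ha.continuous.continuousOn
  have h2 := hu.continuousOn_smul hU.isLocallyClosed ha'.continuousOn
  have h3 := hv.continuousOn_smul hU.isLocallyClosed ha.continuous.continuousOn
  refine ⟨h1, h2.add h3, fun ψ k1 k2 k3 => ?_⟩
  have hd : ∀ x, deriv (fun y => ψ y * a y) x = deriv ψ x * a x + ψ x * deriv a x := fun x =>
    deriv_fun_mul (k1.differentiable (by simp) x) (ha.differentiable (by simp) x)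
  have hs : tsupport (fun y => ψ y * a y) ⊆ U := (tsupport_mul_subset_left).trans k3
  have key := H (fun y => ψ y * a y) (k1.mul ha) k2.mul_right hs
  have i1 := (integrable_smul_of_tsupport_subset h1 (k1.continuous_deriv (by simp)) k2.deriv
    (tsupport_deriv_subset.trans k3)).restrict (s := U)
  have i2 := (integrable_smul_of_tsupport_subset h2 k1.continuous k2 k3).restrict (s := U)
  have i3 := (integrable_smul_of_tsupport_subset h3 k1.continuous k2 k3).restrict (s := U)
  simp only [hd, add_smul, mul_smul] at key
  simp only [smul_add]
  rw [integral_add i1 i2] at key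
  rw [integral_add i2 i3, key]
  ring

end WeakDerivatives

/-! ### Integrable weak derivatives and primitives on an interval. -/

section Primitives

variable {a b : ℝ} {u v w : ℝ → ℂ}

lemma contDiff_primitive {χ : ℝ → ℝ} (hχ : ContDiff ℝ ∞ χ) :
    ContDiff ℝ ∞ (fun x => ∫ t in a..x, χ t) ∧
      deriv (fun x => ∫ t in a..x, χ t) = χ := by
  have hd : ∀ x, HasDerivAt (fun x => ∫ t in a..x, χ t) (χ x) x := fun x =>
    intervalIntegral.integral_hasDerivAt_right (hχ.continuous.intervalIntegrable _ _)
      hχ.continuous.stronglyMeasurable.stronglyMeasurableAtFilter hχ.continuous.continuousAt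
  have hd' : deriv (fun x => ∫ t in a..x, χ t) = χ := funext fun x => (hd x).deriv
  refine ⟨?_, hd'⟩
  rw [contDiff_infty_iff_deriv, hd']
  exact ⟨fun x => (hd x).differentiableAt, hχ⟩

lemma exists_Icc_subset_of_isCompact {K : Set ℝ} (hab : a < b) (hK : IsCompact K)
    (hs : K ⊆ Ioo a b) : ∃ a' b', a < a' ∧ a' ≤ b' ∧ b' < b ∧ K ⊆ Icc a' b' := by
  rcases K.eq_empty_or_nonempty with rfl | hne
  · exact ⟨(a + b) / 2, (a + b) / 2, by linarith, le_rfl, by linarith, empty_subset _⟩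
  · refine ⟨sInf K, sSup K, (hs (hK.sInf_mem hne)).1, ?_, (hs (hK.sSup_mem hne)).2, ?_⟩
    · exact (csInf_le hK.bddBelow hne.some_mem).trans (le_csSup hK.bddAbove hne.some_mem)
    · exact fun x hx => ⟨csInf_le hK.bddBelow hx, le_csSup hK.bddAbove hx⟩

/-- The primitive from `a` vanishes to the left of the support trivially, and to the right of it
because the total integral is zero. -/
lemma exists_deriv_eq_of_integral_eq_zero {χ : ℝ → ℝ} (hab : a < b) (hχ : ContDiff ℝ ∞ χ)
    (hc : HasCompactSupport χ) (hs : tsupport χ ⊆ Ioo a b) (h0 : ∫ x, χ x = 0) :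
    ∃ Ψ : ℝ → ℝ, ContDiff ℝ ∞ Ψ ∧ HasCompactSupport Ψ ∧ tsupport Ψ ⊆ Ioo a b ∧
      deriv Ψ = χ := by
  obtain ⟨a', b', ha, hab', hb, hK⟩ := exists_Icc_subset_of_isCompact hab hc hs
  have hz : ∀ x, x ∉ Icc a' b' → χ x = 0 := fun x hx =>
    image_eq_zero_of_notMem_tsupport fun h => hx (hK h)
  obtain ⟨h1, h2⟩ := contDiff_primitive (a := a) hχ
  have hsupp : Function.support (fun x => ∫ t in a..x, χ t) ⊆ Icc a' b' := by
    intro x hx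
    by_contra hx'
    apply hx
    rcases lt_or_ge x a' with h | h
    · change ∫ t in a..x, χ t = 0
      rw [intervalIntegral.integral_congr (g := fun _ => (0 : ℝ)) (fun t ht => hz t ?_)]
      · simp
      · intro ht'
        rcases le_max_iff.1 ht.2 with h | h <;> linarith [ht'.1]
    · have hbx : b' < x := not_le.1 fun h' => hx' ⟨h, h'⟩
      change ∫ t in a..x, χ t = 0
      rw [intervalIntegral.integral_of_le (by linarith), ← h0]
      apply setIntegral_eq_integral_of_forall_compl_eq_zero
      intro t ht
      apply hz
      rintro ⟨h3, h4⟩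
      exact ht ⟨by linarith, by linarith⟩
  have ht : tsupport (fun x => ∫ t in a..x, χ t) ⊆ Icc a' b' :=
    closure_minimal hsupp isClosed_Icc
  refine ⟨_, h1, isCompact_Icc.of_isClosed_subset (isClosed_tsupport _) ht,
    ht.trans (Icc_subset_Ioo ha hb), h2⟩

/-- The du Bois-Reymond lemma. With `η` a bump of integral one, `ψ - (∫ ψ) η` has mean zero, hence
is the derivative of a test function; the constant is `∫ η w`. -/
lemma ae_eq_const_of_integral_deriv_smul_eq_zero (hab : a < b)
    (hw : LocallyIntegrableOn w (Ioo a b))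
    (h : ∀ ψ : ℝ → ℝ, ContDiff ℝ ∞ ψ → HasCompactSupport ψ → tsupport ψ ⊆ Ioo a b →
      ∫ x, deriv ψ x • w x = 0) :
    ∃ C : ℂ, w =ᵐ[volume.restrict (Ioo a b)] fun _ => C := by
  let B : ContDiffBump ((a + b) / 2) := ⟨(b - a) / 8, (b - a) / 4, by linarith, by linarith⟩
  let η : ℝ → ℝ := B.normed volume
  have hη : ContDiff ℝ ∞ η := B.contDiff_normed
  have hηc : HasCompactSupport η := B.hasCompactSupport_normed
  have hηi : ∫ x, η x = 1 := B.integral_normed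
  have hηs : tsupport η ⊆ Ioo a b := by
    rw [B.tsupport_normed_eq, Real.closedBall_eq_Icc]
    apply Icc_subset_Ioo <;> (simp only [B]; linarith)
  refine ⟨∫ x, η x • w x, ?_⟩
  rw [EventuallyEq, ae_restrict_iff' measurableSet_Ioo]
  have hwc : LocallyIntegrableOn (w - fun _ => ∫ x, η x • w x) (Ioo a b) :=
    hw.sub (locallyIntegrableOn_const _)
  have key := isOpen_Ioo.ae_eq_zero_of_integral_contDiff_smul_eq_zero hwc ?_
  · filter_upwards [key] with x hx hxU using sub_eq_zero.1 (hx hxU)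
  intro ψ h1 h2 h3
  have iψ : Integrable ψ := h1.continuous.integrable_of_hasCompactSupport h2
  have iη : Integrable η := hη.continuous.integrable_of_hasCompactSupport hηc
  have iψw := integrable_smul_of_tsupport_subset hw h1.continuous h2 h3
  have iηw := integrable_smul_of_tsupport_subset hw hη.continuous hηc hηs
  have hsub : tsupport (fun x => ψ x - (∫ t, ψ t) * η x) ⊆ tsupport ψ ∪ tsupport η := by
    refine (tsupport_sub ψ (fun x => (∫ t, ψ t) * η x)).trans (union_subset_union_right _ ?_)
    exact tsupport_mul_subset_right
  obtain ⟨Ψ, g1, g2, g3, g4⟩ := exists_deriv_eq_of_integral_eq_zero hab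
    (χ := fun x => ψ x - (∫ t, ψ t) * η x) (h1.sub (contDiff_const.mul hη))
    (h2.sub hηc.mul_left) (hsub.trans (union_subset h3 hηs))
    (by rw [integral_sub iψ (iη.const_mul _), integral_const_mul, hηi]; ring)
  have e := h Ψ g1 g2 g3
  rw [g4] at e
  simp only [sub_smul, mul_smul] at e
  rw [integral_sub iψw (by exact iηw.smul (∫ t, ψ t)), integral_smul] at e
  simp only [Pi.sub_apply, smul_sub]
  rw [integral_sub iψw (iψ.smul_const _), integral_smul_const, e]

/-- Fubini on the triangle `t ≤ x`: the inner integral of `deriv ψ` over `[t, b)` is `-ψ t`, since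
`ψ b = 0`. -/
lemma isWeakDeriv_primitive (hab : a < b) (hv : IntegrableOn v (Ioo a b)) :
    IsWeakDeriv (Ioo a b) 1 (fun x => ∫ t in a..x, v t) v := by
  have hvc : IntegrableOn v (uIcc a b) := by
    rw [uIcc_of_le hab.le, integrableOn_Icc_iff_integrableOn_Ioo]; exact hv
  have hcont := intervalIntegral.continuousOn_primitive_interval hvc
  rw [uIcc_of_le hab.le] at hcont
  rw [isWeakDeriv_one_iff]
  refine ⟨(hcont.mono Ioo_subset_Icc_self).locallyIntegrableOn measurableSet_Ioo,
    hv.locallyIntegrableOn, fun ψ h1 h2 h3 => ?_⟩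
  have hψ' : Continuous (deriv ψ) := h1.continuous_deriv (by simp)
  let F : ℝ × ℝ → ℂ := indicator {p | p.2 ≤ p.1} fun p => deriv ψ p.1 • v p.2
  have hF : Integrable F ((volume.restrict (Ioo a b)).prod (volume.restrict (Ioo a b))) := by
    apply Integrable.indicator _ (measurableSet_le measurable_snd measurable_fst)
    exact Integrable.smul_prod (hψ'.integrable_of_hasCompactSupport h2.deriv).restrict hv
  have e1 : ∀ x ∈ Ioo a b, ∫ t in Ioo a b, F (x, t) = deriv ψ x • ∫ t in a..x, v t := by
    intro x hx
    have : ∀ t, F (x, t) = indicator (Iic x) (fun t => deriv ψ x • v t) t := fun t => by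
      by_cases h : t ≤ x <;> simp [F, indicator, h]
    simp only [this]
    rw [setIntegral_indicator measurableSet_Iic, integral_smul,
      intervalIntegral.integral_of_le hx.1.le]
    congr 3
    ext t
    simp only [mem_inter_iff, mem_Ioo, mem_Iic, mem_Ioc]
    exact ⟨fun h => ⟨h.1.1, h.2⟩, fun h => ⟨⟨h.1, h.2.trans_lt hx.2⟩, h.2⟩⟩
  have hψb : ψ b = 0 := image_eq_zero_of_notMem_tsupport fun h => lt_irrefl _ (h3 h).2
  have e2 : ∀ t ∈ Ioo a b, ∫ x in Ioo a b, F (x, t) = - (ψ t • v t) := by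
    intro t ht
    have : ∀ x, F (x, t) = indicator (Ici t) (fun x => deriv ψ x • v t) x := fun x => by
      by_cases h : t ≤ x <;> simp [F, indicator, h]
    simp only [this]
    rw [setIntegral_indicator measurableSet_Ici, integral_smul_const]
    have hset : Ioo a b ∩ Ici t = Ico t b := by
      ext x
      simp only [mem_inter_iff, mem_Ioo, mem_Ici, mem_Ico]
      exact ⟨fun h => ⟨h.2, h.1.2⟩, fun h => ⟨⟨ht.1.trans_le h.1, h.2⟩, h.1⟩⟩
    rw [hset, integral_Ico_eq_integral_Ioo, ← integral_Ioc_eq_integral_Ioo,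
      ← intervalIntegral.integral_of_le ht.2.le, intervalIntegral.integral_deriv_eq_sub
        (fun x _ => h1.differentiable (by simp) x) (hψ'.intervalIntegrable _ _), hψb]
    simp
  rw [← setIntegral_congr_fun measurableSet_Ioo e1, integral_integral_swap (f := fun x t => F (x, t)) hF,
    setIntegral_congr_fun measurableSet_Ioo e2, integral_neg, neg_neg]

/-- A function with an integrable weak derivative agrees almost everywhere with a primitive. -/
lemma IsWeakDeriv.ae_eq_primitive (hab : a < b) (hv : IntegrableOn v (Ioo a b))
    (H : IsWeakDeriv (Ioo a b) 1 u v) :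
    ∃ C : ℂ, u =ᵐ[volume.restrict (Ioo a b)] fun x => C + ∫ t in a..x, v t := by
  have H' := isWeakDeriv_primitive hab hv
  rw [isWeakDeriv_one_iff] at H H'
  obtain ⟨C, hC⟩ := ae_eq_const_of_integral_deriv_smul_eq_zero hab (H.1.sub H'.1) (by
    intro ψ h1 h2 h3
    have h1' : Continuous (deriv ψ) := h1.continuous_deriv (by simp)
    have h3' := tsupport_deriv_subset.trans h3
    simp only [Pi.sub_apply, smul_sub]
    rw [integral_sub (integrable_smul_of_tsupport_subset H.1 h1' h2.deriv h3')
      (integrable_smul_of_tsupport_subset H'.1 h1' h2.deriv h3'),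
      ← setIntegral_smul_of_tsupport_subset h3', ← setIntegral_smul_of_tsupport_subset h3',
      ← neg_inj, neg_sub', sub_neg_eq_add, ← H.2.2 ψ h1 h2 h3, H'.2.2 ψ h1 h2 h3]
    simp)
  refine ⟨C, hC.mono fun x hx => ?_⟩
  simp only [Pi.sub_apply] at hx
  rw [← hx]; ring

end Primitives

/-! ### The Möbius change of variables. -/

section ChangeOfVariables

variable {c : ℝ}

/-- The derivative of `phi c` expressed in the variable `x = phi c θ`. -/
noncomputable def phiDeriv (c x : ℝ) : ℝ := (c ^ 2 + x ^ 2) / (2 * c)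

/-- The inverse of `phi c`. -/
noncomputable def phiInv (c x : ℝ) : ℝ := Real.pi + 2 * Real.arctan (x / c)

lemma phiDeriv_pos (hc : 0 < c) (x : ℝ) : 0 < phiDeriv c x := by
  unfold phiDeriv; positivity

lemma le_phiDeriv (hc : 0 < c) (x : ℝ) : c / 2 ≤ phiDeriv c x := by
  unfold phiDeriv
  rw [div_le_div_iff₀ (by norm_num) (by positivity)]
  nlinarith [sq_nonneg x]

lemma sin_half_pos {θ : ℝ} (hθ : θ ∈ Ioo 0 (2 * Real.pi)) : 0 < Real.sin (θ / 2) :=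
  Real.sin_pos_of_pos_of_lt_pi (by linarith [hθ.1]) (by linarith [hθ.2])

lemma hasDerivAt_phi (hc : 0 < c) {θ : ℝ} (hθ : θ ∈ Ioo 0 (2 * Real.pi)) :
    HasDerivAt (phi c) (phiDeriv c (phi c θ)) θ := by
  have hs := (sin_half_pos hθ).ne'
  have h1 : HasDerivAt (fun θ : ℝ => θ / 2) (1 / 2) θ := (hasDerivAt_id θ).div_const 2
  have h2 := ((h1.cos.div h1.sin hs).const_mul (-c))
  have h3 : phi c = fun θ => -c * (Real.cos (θ / 2) / Real.sin (θ / 2)) := by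
    funext θ; rw [phi, Real.cot_eq_cos_div_sin]
  rw [h3]
  refine h2.congr_deriv ?_
  unfold phiDeriv
  field_simp
  ring

lemma deriv_phi (hc : 0 < c) {θ : ℝ} (hθ : θ ∈ Ioo 0 (2 * Real.pi)) :
    deriv (phi c) θ = phiDeriv c (phi c θ) := (hasDerivAt_phi hc hθ).deriv

lemma phiInv_mem (c x : ℝ) : phiInv c x ∈ Ioo 0 (2 * Real.pi) := by
  have h1 := Real.neg_pi_div_two_lt_arctan (x / c)
  have h2 := Real.arctan_lt_pi_div_two (x / c)
  unfold phiInv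
  constructor <;> linarith

lemma phi_eq_tan (c θ : ℝ) : phi c θ = c * Real.tan ((θ - Real.pi) / 2) := by
  rw [phi, Real.cot_eq_cos_div_sin, Real.tan_eq_sin_div_cos,
    show (θ - Real.pi) / 2 = θ / 2 - Real.pi / 2 by ring, Real.sin_sub_pi_div_two,
    Real.cos_sub_pi_div_two]
  ring

lemma phi_phiInv (hc : 0 < c) (x : ℝ) : phi c (phiInv c x) = x := by
  rw [phi_eq_tan, phiInv, show (Real.pi + 2 * Real.arctan (x / c) - Real.pi) / 2 =
    Real.arctan (x / c) by ring, Real.tan_arctan]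
  field_simp

lemma phiInv_phi (hc : 0 < c) {θ : ℝ} (hθ : θ ∈ Ioo 0 (2 * Real.pi)) :
    phiInv c (phi c θ) = θ := by
  rw [phi_eq_tan, phiInv, mul_div_cancel_left₀ _ hc.ne',
    Real.arctan_tan (by linarith [hθ.1]) (by linarith [hθ.2])]
  ring

lemma contDiff_phiInv (c : ℝ) : ContDiff ℝ ∞ (phiInv c) := by
  unfold phiInv
  exact contDiff_const.add (contDiff_const.mul (Real.contDiff_arctan.comp (contDiff_id.div_const c)))

lemma hasDerivAt_phiInv (hc : 0 < c) (x : ℝ) :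
    HasDerivAt (phiInv c) (phiDeriv c x)⁻¹ x := by
  have h := (((hasDerivAt_id x).div_const c).arctan.const_mul 2).const_add Real.pi
  refine HasDerivAt.congr_deriv (f := phiInv c) h ?_
  unfold phiDeriv
  simp only [id]
  field_simp

lemma tendsto_phiInv_atTop (hc : 0 < c) : Tendsto (phiInv c) atTop (𝓝 (2 * Real.pi)) := by
  have h := (tendsto_nhds_of_tendsto_nhdsWithin Real.tendsto_arctan_atTop).comp
    (tendsto_id.atTop_div_const hc)
  have h' := (h.const_mul 2).const_add Real.pi
  rwa [show Real.pi + 2 * (Real.pi / 2) = 2 * Real.pi by ring] at h'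

lemma tendsto_phiInv_atBot (hc : 0 < c) : Tendsto (phiInv c) atBot (𝓝 0) := by
  have h := (tendsto_nhds_of_tendsto_nhdsWithin Real.tendsto_arctan_atBot).comp
    (tendsto_id.atBot_div_const hc)
  have h' := (h.const_mul 2).const_add Real.pi
  rwa [show Real.pi + 2 * (-(Real.pi / 2)) = 0 by ring] at h'

lemma phi_injOn (hc : 0 < c) : InjOn (phi c) (Ioo 0 (2 * Real.pi)) := fun x hx y hy h => by
  rw [← phiInv_phi hc hx, h, phiInv_phi hc hy]

lemma phi_image (hc : 0 < c) : phi c '' Ioo 0 (2 * Real.pi) = univ :=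
  eq_univ_of_forall fun x => ⟨phiInv c x, phiInv_mem c x, phi_phiInv hc x⟩

lemma continuousOn_phi (hc : 0 < c) : ContinuousOn (phi c) (Ioo 0 (2 * Real.pi)) :=
  fun _ hθ => (hasDerivAt_phi hc hθ).continuousAt.continuousWithinAt

lemma continuous_phiDeriv (c : ℝ) : Continuous (phiDeriv c) := by
  unfold phiDeriv; fun_prop

variable {E : Type*} [NormedAddCommGroup E] [NormedSpace ℝ E]

lemma integral_comp_phi (hc : 0 < c) (F : ℝ → E) :
    ∫ θ in Ioo 0 (2 * Real.pi), phiDeriv c (phi c θ) • F (phi c θ) = ∫ x, F x := by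
  have h := integral_image_eq_integral_abs_deriv_smul measurableSet_Ioo
    (fun θ hθ => (hasDerivAt_phi hc hθ).hasDerivWithinAt) (phi_injOn hc) F
  simp only [abs_of_pos (phiDeriv_pos hc _)] at h
  rw [← h, phi_image hc, setIntegral_univ]

lemma integrableOn_comp_phi_iff (hc : 0 < c) (F : ℝ → E) :
    IntegrableOn (fun θ => phiDeriv c (phi c θ) • F (phi c θ)) (Ioo 0 (2 * Real.pi)) ↔
      Integrable F := by
  have h := integrableOn_image_iff_integrableOn_abs_deriv_smul measurableSet_Ioo
    (fun θ hθ => (hasDerivAt_phi hc hθ).hasDerivWithinAt) (phi_injOn hc) F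
  simp only [abs_of_pos (phiDeriv_pos hc _)] at h
  rw [← h, phi_image hc, integrableOn_univ]

lemma locallyIntegrableOn_comp_phi (hc : 0 < c) {F : ℝ → E} (hF : LocallyIntegrableOn F univ) :
    LocallyIntegrableOn (fun θ => F (phi c θ)) (Ioo 0 (2 * Real.pi)) := by
  rw [locallyIntegrableOn_iff isOpen_Ioo.isLocallyClosed]
  intro K hK hKc
  have hcont := (continuousOn_phi hc).mono hK
  have h1 : IntegrableOn F (phi c '' K) :=
    hF.integrableOn_compact_subset (subset_univ _) (hKc.image_of_continuousOn hcont)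
  rw [integrableOn_image_iff_integrableOn_abs_deriv_smul hKc.measurableSet
    (fun θ hθ => (hasDerivAt_phi hc (hK hθ)).hasDerivWithinAt) ((phi_injOn hc).mono hK)] at h1
  have h2 : ContinuousOn (fun θ => (phiDeriv c (phi c θ))⁻¹) K :=
    ((continuous_phiDeriv c).comp_continuousOn hcont).inv₀ fun θ _ => (phiDeriv_pos hc _).ne'
  refine (h1.continuousOn_smul h2 hKc).congr_fun (fun θ _ => ?_) hKc.measurableSet
  simp only [abs_of_pos (phiDeriv_pos hc _)]
  rw [smul_smul, inv_mul_cancel₀ (phiDeriv_pos hc _).ne', one_smul]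

/-- The chain rule for weak derivatives under the change of variables `phi c`. -/
lemma IsWeakDeriv.comp_phi (hc : 0 < c) {u v : ℝ → ℂ} (H : IsWeakDeriv univ 1 u v) :
    IsWeakDeriv (Ioo 0 (2 * Real.pi)) 1 (fun θ => u (phi c θ))
      (fun θ => phiDeriv c (phi c θ) • v (phi c θ)) := by
  rw [isWeakDeriv_one_iff] at H ⊢
  obtain ⟨hu, hv, H⟩ := H
  have hv' : LocallyIntegrableOn (fun x => phiDeriv c x • v x) univ :=
    hv.continuousOn_smul isOpen_univ.isLocallyClosed (continuous_phiDeriv c).continuousOn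
  refine ⟨locallyIntegrableOn_comp_phi hc hu, locallyIntegrableOn_comp_phi hc hv',
    fun ψ h1 h2 h3 => ?_⟩
  have hΨ : ContDiff ℝ ∞ (fun x => ψ (phiInv c x)) := h1.comp (contDiff_phiInv c)
  have hK : IsCompact (phi c '' tsupport ψ) :=
    h2.image_of_continuousOn ((continuousOn_phi hc).mono h3)
  have hΨc : HasCompactSupport (fun x => ψ (phiInv c x)) := by
    refine HasCompactSupport.intro hK fun x hx => ?_
    refine image_eq_zero_of_notMem_tsupport fun h => hx ⟨_, h, phi_phiInv hc x⟩
  have hd : ∀ x, deriv (fun x => ψ (phiInv c x)) x =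
      (phiDeriv c x)⁻¹ * deriv ψ (phiInv c x) := fun x => by
    have h := ((h1.differentiable (by simp) (phiInv c x)).hasDerivAt.comp x
      (hasDerivAt_phiInv hc x)).deriv
    rw [mul_comm, ← h]
    rfl
  -- After changing variables, the Jacobian supplies the factor `phiDeriv` of the new derivative on
  -- one side, and cancels the factor from `deriv (phiInv c)` on the other.
  have key := H _ hΨ hΨc (subset_univ _)
  simp only [setIntegral_univ, hd] at key
  rw [← integral_comp_phi hc, ← integral_comp_phi hc] at key
  rw [← integral_congr_ae, key, ← integral_congr_ae]
  · filter_upwards [ae_restrict_mem measurableSet_Ioo] with θ hθ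
    rw [phiInv_phi hc hθ, smul_smul, mul_inv_cancel_left₀ (phiDeriv_pos hc _).ne']
  · filter_upwards [ae_restrict_mem measurableSet_Ioo] with θ hθ
    rw [phiInv_phi hc hθ, smul_comm]

end ChangeOfVariables

/-! ### Landau inequalities on a monotone tail. -/

lemma iteratedDeriv_hasDerivAt {v : ℝ → ℝ} (hv : ContDiff ℝ ∞ v) (k : ℕ) (x : ℝ) :
    HasDerivAt (iteratedDeriv k v) (iteratedDeriv (k + 1) v x) x := by
  rw [iteratedDeriv_succ]
  exact (hv.differentiable_iteratedDeriv k (by exact_mod_cast WithTop.coe_lt_top _) x).hasDerivAt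

lemma continuous_iteratedDeriv_of_contDiff {v : ℝ → ℝ} (hv : ContDiff ℝ ∞ v) (k : ℕ) :
    Continuous (iteratedDeriv k v) :=
  continuous_iff_continuousAt.2 fun x => (iteratedDeriv_hasDerivAt hv k x).continuousAt

section Landau

variable {v : ℝ → ℝ} {K : ℝ}

/-- On `(K, ∞)`, the derivative of order `k` of `v` is dominated by the power `v ^ s`. -/
def DerivDominated (v : ℝ → ℝ) (K : ℝ) (k : ℕ) (s : ℝ) : Prop :=
  ∃ C : ℝ, ∀ x, K < x → |iteratedDeriv k v x| ≤ C * v x ^ s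

/-- A Landau type inequality: domination of the derivatives of order `k` and `k + 2`
by powers of a decreasing function implies that of the derivative in between. -/
lemma DerivDominated.interpolate (hv : ContDiff ℝ ∞ v) (hpos : ∀ x, K < x → 0 < v x)
    (hanti : AntitoneOn v (Ioi K)) {k : ℕ} {s t : ℝ} (hs : 0 ≤ s) (ht : 0 ≤ t)
    (h1 : DerivDominated v K k s) (h2 : DerivDominated v K (k + 2) t) :
    DerivDominated v K (k + 1) ((s + t) / 2) := by
  obtain ⟨C₁, h1⟩ := h1
  obtain ⟨C₂, h2⟩ := h2
  refine ⟨2 * C₁ + C₂, fun x hx => ?_⟩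
  have hvx := hpos x hx
  have nonneg : ∀ {C a b : ℝ}, |a| ≤ C * v x ^ b → 0 ≤ C := fun {C a b} h =>
    nonneg_of_mul_nonneg_left ((abs_nonneg a).trans h) (Real.rpow_pos_of_pos hvx b)
  have hC₁ := nonneg (h1 x hx)
  have hC₂ := nonneg (h2 x hx)
  -- Monotonicity freezes the bounds at `x` for every point to its right, so only forward steps are
  -- taken.
  have g1 : ∀ y, x ≤ y → |iteratedDeriv k v y| ≤ C₁ * v x ^ s := fun y hy =>
    (h1 y (hx.trans_le hy)).trans (by
      have := hanti hx (hx.trans_le hy) hy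
      have := (hpos y (hx.trans_le hy)).le
      gcongr)
  have g2 : ∀ y, x ≤ y → |iteratedDeriv (k + 2) v y| ≤ C₂ * v x ^ t := fun y hy =>
    (h2 y (hx.trans_le hy)).trans (by
      have := hanti hx (hx.trans_le hy) hy
      have := (hpos y (hx.trans_le hy)).le
      gcongr)
  -- This step length balances the mean value bounds `v ^ s / h` and `v ^ t * h`: both become `v ^
  -- ((s + t) / 2)`.
  set h := v x ^ ((s - t) / 2) with hh
  have hh0 : 0 < h := Real.rpow_pos_of_pos hvx _
  obtain ⟨ξ, ⟨hξ1, hξ2⟩, hξ⟩ := exists_hasDerivAt_eq_slope (iteratedDeriv k v)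
    (iteratedDeriv (k + 1) v) (show x < x + h by linarith)
    (continuous_iteratedDeriv_of_contDiff hv k).continuousOn
    (fun y _ => iteratedDeriv_hasDerivAt hv k y)
  obtain ⟨ζ, ⟨hζ1, hζ2⟩, hζ⟩ := exists_hasDerivAt_eq_slope (iteratedDeriv (k + 1) v)
    (iteratedDeriv (k + 2) v) hξ1
    (continuous_iteratedDeriv_of_contDiff hv (k + 1)).continuousOn
    (fun y _ => iteratedDeriv_hasDerivAt hv (k + 1) y)
  have e1 : |iteratedDeriv (k + 1) v ξ| * h ≤ 2 * C₁ * v x ^ s := by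
    rw [← abs_of_pos hh0, ← abs_mul, hξ]
    rw [show x + h - x = h by ring, div_mul_cancel₀ _ hh0.ne']
    have := abs_sub (iteratedDeriv k v (x + h)) (iteratedDeriv k v x)
    linarith [g1 (x + h) (by linarith), g1 x le_rfl]
  have e2 : |iteratedDeriv (k + 1) v ξ - iteratedDeriv (k + 1) v x| ≤ C₂ * v x ^ t * h := by
    have hne : ξ - x ≠ 0 := by linarith
    rw [eq_div_iff hne] at hζ
    rw [← hζ, abs_mul, abs_of_pos (by linarith : 0 < ξ - x)]
    have := g2 ζ hζ1.le
    have h3 : ξ - x ≤ h := by linarith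
    have h4 : 0 ≤ ξ - x := by linarith
    exact mul_le_mul this h3 h4 ((abs_nonneg _).trans this)
  have p1 : v x ^ s = v x ^ ((s + t) / 2) * h := by
    rw [hh, ← Real.rpow_add hvx]; ring_nf
  have p2 : v x ^ t * h = v x ^ ((s + t) / 2) := by
    rw [hh, ← Real.rpow_add hvx]; ring_nf
  have e1' : |iteratedDeriv (k + 1) v ξ| ≤ 2 * C₁ * v x ^ ((s + t) / 2) := by
    rw [p1, ← mul_assoc] at e1
    exact le_of_mul_le_mul_right e1 hh0
  have e3 := abs_sub_abs_le_abs_sub (iteratedDeriv (k + 1) v x) (iteratedDeriv (k + 1) v ξ)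
  rw [abs_sub_comm] at e3
  rw [mul_assoc, p2] at e2
  linarith

lemma DerivDominated.mono (hpos : ∀ x, K < x → 0 < v x) {B : ℝ} (hB : ∀ x, K < x → v x ≤ B)
    {k : ℕ} {s t : ℝ} (hst : s ≤ t) (h : DerivDominated v K k t) : DerivDominated v K k s := by
  obtain ⟨C, h⟩ := h
  refine ⟨C * B ^ (t - s), fun x hx => (h x hx).trans ?_⟩
  have hvx := hpos x hx
  have hC : 0 ≤ C := nonneg_of_mul_nonneg_left ((abs_nonneg _).trans (h x hx))
    (Real.rpow_pos_of_pos hvx t)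
  have e : v x ^ t = v x ^ (t - s) * v x ^ s := by rw [← Real.rpow_add hvx]; ring_nf
  rw [e, ← mul_assoc]
  have := hB x hx
  have := sub_nonneg.2 hst
  gcongr

/-- A concave bounded-below sequence is nondecreasing. -/
lemma le_of_concave_of_nonneg {σ : ℕ → ℝ} (h0 : ∀ k, 0 ≤ σ k)
    (hc : ∀ k, σ k + σ (k + 2) ≤ 2 * σ (k + 1)) (k : ℕ) : σ 0 ≤ σ k := by
  refine monotone_nat_of_le_succ (fun k => ?_) (Nat.zero_le k)
  by_contra! hlt
  -- By concavity, one strict decrease forces at least the same decrease at every later step, and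
  -- eventually a negative value.
  have step : ∀ n, σ (k + n + 1) - σ (k + n) ≤ σ (k + 1) - σ k := by
    intro n
    induction n with
    | zero => simp
    | succ n ih =>
      have := hc (k + n)
      rw [show k + (n + 1) + 1 = k + n + 2 by ring, show k + (n + 1) = k + n + 1 by ring]
      linarith
  have lin : ∀ n : ℕ, σ (k + n) ≤ σ k + n * (σ (k + 1) - σ k) := by
    intro n
    induction n with
    | zero => simp
    | succ n ih =>
      have := step n
      rw [show k + (n + 1) = k + n + 1 by ring]
      push_cast
      linarith
  obtain ⟨n, hn⟩ := exists_nat_gt (σ k / (σ k - σ (k + 1)))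
  rw [div_lt_iff₀ (by linarith)] at hn
  linarith [lin n, h0 (k + n)]

/-- All derivatives of a positive decreasing function with bounded derivatives are dominated by
any power of exponent less than one of the function. -/
lemma derivDominated_of_lt_one (hv : ContDiff ℝ ∞ v) (hpos : ∀ x, K < x → 0 < v x)
    (hanti : AntitoneOn v (Ioi K)) (hbd : ∀ k, DerivDominated v K k 0) (k : ℕ) {s : ℝ}
    (hs : s < 1) : DerivDominated v K k s := by
  obtain ⟨B, hB⟩ : ∃ B, ∀ x, K < x → v x ≤ B := by
    obtain ⟨B, hB⟩ := hbd 0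
    exact ⟨B, fun x hx => by simpa using (le_abs_self _).trans (hB x hx)⟩
  -- The admissible exponents for order `k`. Capping them at `1` makes the supremum finite;
  -- `interpolate` makes it concave in `k`.
  let S : ℕ → Set ℝ := fun k => {s | s ∈ Icc 0 1 ∧ DerivDominated v K k s}
  have hS0 : ∀ k, (0 : ℝ) ∈ S k := fun k => ⟨⟨le_rfl, zero_le_one⟩, hbd k⟩
  have hSb : ∀ k, BddAbove (S k) := fun k => ⟨1, fun s hs => hs.1.2⟩
  have hne : ∀ k, (S k).Nonempty := fun k => ⟨0, hS0 k⟩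
  have hσ0 : 1 ≤ sSup (S 0) := le_csSup (hSb 0) ⟨⟨zero_le_one, le_rfl⟩, 1, fun x hx => by
    simp [abs_of_pos (hpos x hx)]⟩
  have hconc : ∀ k, sSup (S k) + sSup (S (k + 2)) ≤ 2 * sSup (S (k + 1)) := by
    intro k
    rw [← le_sub_iff_add_le]
    refine csSup_le (hne k) fun s hs => ?_
    rw [le_sub_comm]
    refine csSup_le (hne (k + 2)) fun t ht => ?_
    have h : (s + t) / 2 ∈ S (k + 1) :=
      ⟨⟨by linarith [hs.1.1, ht.1.1], by linarith [hs.1.2, ht.1.2]⟩,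
        hs.2.interpolate hv hpos hanti hs.1.1 ht.1.1 ht.2⟩
    linarith [le_csSup (hSb (k + 1)) h]
  have hk := hσ0.trans (le_of_concave_of_nonneg (fun k => le_csSup (hSb k) (hS0 k)) hconc k)
  obtain ⟨t, ht, hst⟩ := exists_lt_of_lt_csSup (hne k) (hs.trans_le hk)
  exact ht.2.mono hpos hB hst.le

end Landau

/-! ### Symbol classes relative to the weight. -/

section Symbols

variable {ρ b b₁ b₂ : ℝ → ℝ} {r r₁ r₂ : ℝ} {k : ℕ}

/-- The derivative of order `k` of `b` is dominated by every power `ρ ^ s` with `s < r`. -/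
def DominatedBelow (ρ : ℝ → ℝ) (r : ℝ) (k : ℕ) (b : ℝ → ℝ) : Prop :=
  ∀ s < r, ∃ C : ℝ, ∀ x, |iteratedDeriv k b x| ≤ C * ρ x ^ s

/-- Smooth functions all of whose derivatives are dominated by `ρ ^ s` for every `s < r`. -/
def IsWeightSymbol (ρ : ℝ → ℝ) (r : ℝ) (b : ℝ → ℝ) : Prop :=
  ContDiff ℝ ∞ b ∧ ∀ k, DominatedBelow ρ r k b

lemma DominatedBelow.mul (hρ : ∀ x, 0 < ρ x) (h₁ : ContDiff ℝ ∞ b₁) (h₂ : ContDiff ℝ ∞ b₂)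
    (H₁ : ∀ i ≤ k, DominatedBelow ρ r₁ i b₁) (H₂ : ∀ i ≤ k, DominatedBelow ρ r₂ i b₂) :
    DominatedBelow ρ (r₁ + r₂) k (fun x => b₁ x * b₂ x) := by
  intro s hs
  -- The slack `r₁ + r₂ - s` is shared equally between the two factors of each Leibniz term.
  have hδ : 0 < (r₁ + r₂ - s) / 2 := by linarith
  have C₁ := fun i : Fin (k + 1) => H₁ i (Nat.lt_succ_iff.1 i.2) (r₁ - (r₁ + r₂ - s) / 2)
    (by linarith)
  have C₂ := fun i : Fin (k + 1) => H₂ (k - i) (Nat.sub_le _ _) (r₂ - (r₁ + r₂ - s) / 2)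
    (by linarith)
  choose C₁ hC₁ using C₁
  choose C₂ hC₂ using C₂
  refine ⟨∑ i : Fin (k + 1), (k.choose i : ℝ) * (C₁ i * C₂ i), fun x => ?_⟩
  rw [iteratedDeriv_fun_mul (h₁.of_le (by exact_mod_cast le_top)).contDiffAt
    (h₂.of_le (by exact_mod_cast le_top)).contDiffAt, Finset.sum_range, Finset.sum_mul]
  refine (Finset.abs_sum_le_sum_abs _ _).trans (Finset.sum_le_sum fun i _ => ?_)
  have e := mul_le_mul (hC₁ i x) (hC₂ i x) (abs_nonneg _) ((abs_nonneg _).trans (hC₁ i x))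
  have e' : ρ x ^ (r₁ - (r₁ + r₂ - s) / 2) * ρ x ^ (r₂ - (r₁ + r₂ - s) / 2) = ρ x ^ s := by
    rw [← Real.rpow_add (hρ x)]; ring_nf
  rw [mul_assoc, abs_mul, abs_mul, Nat.abs_cast, mul_assoc]
  refine mul_le_mul_of_nonneg_left (e.trans_eq ?_) (Nat.cast_nonneg _)
  rw [← e']; ring

lemma IsWeightSymbol.mul (hρ : ∀ x, 0 < ρ x) (h₁ : IsWeightSymbol ρ r₁ b₁)
    (h₂ : IsWeightSymbol ρ r₂ b₂) : IsWeightSymbol ρ (r₁ + r₂) (fun x => b₁ x * b₂ x) :=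
  ⟨h₁.1.mul h₂.1, fun _ => DominatedBelow.mul hρ h₁.1 h₂.1 (fun i _ => h₁.2 i) fun i _ => h₂.2 i⟩

lemma IsWeightSymbol.add (h₁ : IsWeightSymbol ρ r b₁) (h₂ : IsWeightSymbol ρ r b₂) :
    IsWeightSymbol ρ r (fun x => b₁ x + b₂ x) := by
  refine ⟨h₁.1.add h₂.1, fun k s hs => ?_⟩
  obtain ⟨C₁, hC₁⟩ := h₁.2 k s hs
  obtain ⟨C₂, hC₂⟩ := h₂.2 k s hs
  refine ⟨C₁ + C₂, fun x => ?_⟩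
  rw [iteratedDeriv_fun_add (h₁.1.of_le (by exact_mod_cast le_top)).contDiffAt
    (h₂.1.of_le (by exact_mod_cast le_top)).contDiffAt, add_mul]
  exact (abs_add_le _ _).trans (add_le_add (hC₁ x) (hC₂ x))

lemma IsWeightSymbol.deriv (h : IsWeightSymbol ρ r b) : IsWeightSymbol ρ r (deriv b) := by
  have h' := h.1
  refine ⟨by fun_prop, fun k s hs => ?_⟩
  rw [← iteratedDeriv_succ']
  exact h.2 (k + 1) s hs

lemma isWeightSymbol_zero : IsWeightSymbol ρ r (fun _ => 0) :=
  ⟨contDiff_const, fun k _ _ => ⟨0, fun x => by simp⟩⟩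

/-- For `s < 0` the power `ρ ^ s` outgrows every polynomial, as `(1 + |x|) ^ M * ρ x` is bounded for
each `M`. -/
lemma isWeightSymbol_zero_of_hasTemperateGrowth (ρ : 𝓢(ℝ, ℝ)) (hρ : ∀ x, 0 < ρ x)
    (hb : b.HasTemperateGrowth) : IsWeightSymbol ρ 0 b := by
  refine ⟨hb.1, fun k s hs => ?_⟩
  obtain ⟨N, C, hC⟩ := hb.2 k
  obtain ⟨M, hM⟩ := exists_nat_ge ((N : ℝ) / (-s))
  rw [div_le_iff₀ (by linarith)] at hM
  obtain ⟨D, hD⟩ : ∃ D : ℝ, ∀ x, (1 + |x|) ^ M * ρ x ≤ D := by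
    have h := SchwartzMap.one_add_le_sup_seminorm_apply (𝕜 := ℝ) (m := (M, 0)) le_rfl le_rfl ρ
    refine ⟨_, fun x => le_trans (le_of_eq ?_) (h x)⟩
    rw [norm_iteratedFDeriv_zero, Real.norm_of_nonneg (hρ x).le, Real.norm_eq_abs]
  have hC0 : 0 ≤ C := by simpa using (norm_nonneg _).trans (hC 0)
  refine ⟨C * D ^ (-s), fun x => ?_⟩
  have hx := hρ x
  have h1x : 1 ≤ 1 + |x| := by linarith [abs_nonneg x]
  have h0x : 0 ≤ 1 + |x| := by linarith
  have e1 : (1 + |x|) ^ N ≤ D ^ (-s) * ρ x ^ s := by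
    have e2 : (1 + |x|) ^ M ≤ D / ρ x := by rw [le_div_iff₀ hx]; exact hD x
    calc (1 + |x|) ^ N = (1 + |x|) ^ (N : ℝ) := (Real.rpow_natCast _ _).symm
      _ ≤ (1 + |x|) ^ (M * -s) := Real.rpow_le_rpow_of_exponent_le h1x hM
      _ = ((1 + |x|) ^ M) ^ (-s) := by rw [Real.rpow_mul h0x, Real.rpow_natCast]
      _ ≤ (D / ρ x) ^ (-s) := Real.rpow_le_rpow (by positivity) e2 (by linarith)
      _ = D ^ (-s) * ρ x ^ s := by
        have hD0 : 0 ≤ D := le_trans (by positivity) (hD x)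
        rw [Real.div_rpow hD0 hx.le, Real.rpow_neg hx.le, div_inv_eq_mul]
  rw [mul_assoc]
  calc |iteratedDeriv k b x| = ‖iteratedFDeriv ℝ k b x‖ := by
        rw [norm_iteratedFDeriv_eq_norm_iteratedDeriv, Real.norm_eq_abs]
    _ ≤ C * (1 + ‖x‖) ^ N := hC x
    _ ≤ _ := mul_le_mul_of_nonneg_left e1 hC0

lemma exists_abs_iteratedDeriv_le (ρ : 𝓢(ℝ, ℝ)) (k : ℕ) :
    ∃ C : ℝ, ∀ x, |iteratedDeriv k ρ x| ≤ C := by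
  obtain ⟨C, -, hC⟩ := ρ.decay 0 k
  refine ⟨C, fun x => ?_⟩
  simpa [norm_iteratedFDeriv_eq_norm_iteratedDeriv] using hC x

/-- The right tail is a Landau estimate, the left tail the same for `ρ (-x)`, and on `[-K, K]`
positivity and compactness suffice. -/
lemma IsMonotonicWeight.isWeightSymbol_one {ρ : 𝓢(ℝ, ℝ)} (hρ : IsMonotonicWeight ρ) :
    IsWeightSymbol ρ 1 ρ := by
  obtain ⟨hpos, K, hK, hmono⟩ := hρ
  have hsm : ContDiff ℝ ∞ ρ := ρ.smooth'
  refine ⟨hsm, fun k s hs => ?_⟩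
  have hdiff : Differentiable ℝ ρ := hsm.differentiable (by simp)
  obtain ⟨C₁, h₁⟩ : DerivDominated ρ K k s := by
    refine derivDominated_of_lt_one hsm (fun x _ => hpos x) ?_ (fun k => ?_) k hs
    · refine antitoneOn_of_deriv_nonpos (convex_Ioi K) hsm.continuous.continuousOn
        hdiff.differentiableOn fun x hx => ?_
      rw [interior_Ioi] at hx
      have hx : K < x := hx
      have := hmono x fun h => absurd h.2 (not_le.2 hx)
      exact nonpos_of_mul_nonpos_right this (hK.trans hx)
    · obtain ⟨C, hC⟩ := exists_abs_iteratedDeriv_le ρ k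
      exact ⟨C, fun x _ => by simpa using hC x⟩
  obtain ⟨C₂, h₂⟩ : DerivDominated (fun x => ρ (-x)) K k s := by
    refine derivDominated_of_lt_one (hsm.comp contDiff_neg) (fun x _ => hpos _) ?_
      (fun k => ?_) k hs
    · refine antitoneOn_of_deriv_nonpos (convex_Ioi K)
        (hsm.continuous.comp continuous_neg).continuousOn
        (hdiff.comp differentiable_neg).differentiableOn fun x hx => ?_
      rw [interior_Ioi] at hx
      have hx : K < x := hx
      have h := hmono (-x) fun h => absurd h.1 (not_le.2 (by linarith))
      change deriv (fun x => ρ (-x)) x ≤ 0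
      rw [deriv_comp_neg]
      have : 0 ≤ deriv (fun y => ρ y) (-x) := nonneg_of_mul_nonpos_right h (by linarith)
      linarith
    · obtain ⟨C, hC⟩ := exists_abs_iteratedDeriv_le ρ k
      refine ⟨C, fun x _ => ?_⟩
      change |iteratedDeriv k (fun x => ρ (-x)) x| ≤ C * ρ (-x) ^ (0 : ℝ)
      rw [iteratedDeriv_comp_neg]
      simpa [abs_mul] using hC (-x)
  obtain ⟨C₃, h₃⟩ : ∃ C, ∀ x ∈ Icc (-K) K, |iteratedDeriv k ρ x| / ρ x ^ s ≤ C := by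
    have hc : ContinuousOn (fun x => |iteratedDeriv k ρ x| / ρ x ^ s) (Icc (-K) K) :=
      ((continuous_iteratedDeriv_of_contDiff hsm k).abs.div
        (hsm.continuous.rpow_const fun x => Or.inl (hpos x).ne')
        fun x => (Real.rpow_pos_of_pos (hpos x) s).ne').continuousOn
    obtain ⟨C, hC⟩ := isCompact_Icc.bddAbove_image hc
    exact ⟨C, fun x hx => hC ⟨x, hx, rfl⟩⟩
  refine ⟨max C₁ (max C₂ C₃), fun x => ?_⟩
  have hp := Real.rpow_pos_of_pos (hpos x) s
  by_cases hx : x ∈ Icc (-K) K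
  · refine ((div_le_iff₀ hp).1 (h₃ x hx)).trans ?_
    gcongr
    exact (le_max_right _ _).trans (le_max_right _ _)
  · rcases lt_or_ge K x with h | h
    · refine (h₁ x h).trans ?_
      gcongr
      exact le_max_left _ _
    · have hx' : K < -x := by
        by_contra! h'
        exact hx ⟨by linarith, h⟩
      have h4 := h₂ (-x) hx'
      rw [iteratedDeriv_comp_neg, neg_neg] at h4
      simp only [smul_eq_mul, abs_mul, abs_pow, abs_neg, abs_one, one_pow, one_mul,
        neg_neg] at h4
      refine h4.trans ?_
      gcongr
      exact (le_max_left _ _).trans (le_max_right _ _)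

lemma IsMonotonicWeight.isWeightSymbol_rpow {ρ : 𝓢(ℝ, ℝ)} (hρ : IsMonotonicWeight ρ) (r : ℝ) :
    IsWeightSymbol ρ r (fun x => ρ x ^ r) := by
  have hpos := hρ.1
  have hsm : ContDiff ℝ ∞ ρ := ρ.smooth'
  have hcd : ∀ r : ℝ, ContDiff ℝ ∞ (fun x => ρ x ^ r) := fun r =>
    hsm.rpow_const_of_ne fun x => (hpos x).ne'
  refine ⟨hcd r, fun k => ?_⟩
  -- Since `(ρ ^ r)' = r ρ ^ (r - 1) ρ'`, the Leibniz rule needs all lower orders at exponent `r -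
  -- 1`; the factor `ρ'` restores the missing `1`.
  induction k using Nat.strong_induction_on generalizing r with
  | _ k ih =>
  rcases k with _ | k
  · intro s hs
    obtain ⟨B, hB⟩ := exists_abs_iteratedDeriv_le ρ 0
    refine ⟨B ^ (r - s), fun x => ?_⟩
    have hx := hpos x
    have hBx : ρ x ≤ B := by simpa using (le_abs_self _).trans (hB x)
    rw [iteratedDeriv_zero, abs_of_pos (Real.rpow_pos_of_pos hx r)]
    calc ρ x ^ r = ρ x ^ (r - s) * ρ x ^ s := by rw [← Real.rpow_add hx]; ring_nf
      _ ≤ _ := by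
        have : 0 ≤ r - s := by linarith
        gcongr
  · intro s hs
    have hd : deriv (fun x => ρ x ^ r) = fun x => r * (ρ x ^ (r - 1) * deriv ρ x) := by
      funext x
      rw [((hsm.differentiable (by simp) x).hasDerivAt.rpow_const (Or.inl (hpos x).ne')).deriv]
      ring
    have hρ1 := hρ.isWeightSymbol_one.deriv
    have h := DominatedBelow.mul (k := k) hpos (hcd (r - 1)) hρ1.1
      (fun i hi => ih i (Nat.lt_succ_iff.2 hi) (r - 1)) fun i _ => hρ1.2 i
    obtain ⟨C, hC⟩ := h s (by linarith)
    refine ⟨|r| * C, fun x => ?_⟩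
    rw [iteratedDeriv_succ', hd, iteratedDeriv_const_mul_field, abs_mul, mul_assoc]
    exact mul_le_mul_of_nonneg_left (hC x) (abs_nonneg r)

end Symbols

/-! ### Expansion and weighted bound of the transformed derivatives. -/

section Transform

variable {c p q : ℝ} {ρ : 𝓢(ℝ, ℝ)} {f : ℝ → ℂ} {α τ : ℕ}

/-- The coefficient `a τ j` of `u⁽ʲ⁾` in the expansion of `(m D)^τ (w u)`. -/
noncomputable def transCoeff (m w : ℝ → ℝ) : ℕ → ℕ → ℝ → ℝ
  | 0, 0 => w
  | 0, _ + 1 => fun _ => 0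
  | τ + 1, 0 => fun x => m x * deriv (transCoeff m w τ 0) x
  | τ + 1, j + 1 => fun x => m x * (deriv (transCoeff m w τ (j + 1)) x + transCoeff m w τ j x)

lemma transCoeff_eq_zero (m w : ℝ → ℝ) {τ j : ℕ} (h : τ < j) :
    transCoeff m w τ j = fun _ => 0 := by
  induction τ generalizing j with
  | zero => cases j with
    | zero => omega
    | succ j => rfl
  | succ τ ih => cases j with
    | zero => omega
    | succ j =>
      rw [transCoeff, ih (j := j + 1) (by omega), ih (j := j) (by omega)]
      simp

/-- The recursion only differentiates, adds and multiplies by `m`, a symbol of exponent `0`, so the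
exponent `r` never degrades. -/
lemma isWeightSymbol_transCoeff {ρ m w : ℝ → ℝ} {r : ℝ} (hρ : ∀ x, 0 < ρ x)
    (hm : IsWeightSymbol ρ 0 m) (hw : IsWeightSymbol ρ r w) (τ j : ℕ) :
    IsWeightSymbol ρ r (transCoeff m w τ j) := by
  have hmul : ∀ {b}, IsWeightSymbol ρ r b → IsWeightSymbol ρ r (fun x => m x * b x) :=
    fun hb => by simpa using hm.mul hρ hb
  induction τ generalizing j with
  | zero => cases j with
    | zero => exact hw
    | succ j => exact isWeightSymbol_zero
  | succ τ ih => cases j with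
    | zero => exact hmul (ih 0).deriv
    | succ j => exact hmul ((ih (j + 1)).deriv.add (ih j))

/-- The weight `(ρ φ')^{1/p}` in the variable `x = phi c θ`. -/
noncomputable def transWeight (c p : ℝ) (ρ : ℝ → ℝ) (x : ℝ) : ℝ :=
  ρ x ^ (1 / p) * phiDeriv c x ^ (1 / p)

lemma isWeightSymbol_phiDeriv (hρ : IsMonotonicWeight ρ) (c : ℝ) :
    IsWeightSymbol ρ 0 (phiDeriv c) := by
  apply isWeightSymbol_zero_of_hasTemperateGrowth ρ hρ.1
  unfold phiDeriv
  simp only [div_eq_mul_inv]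
  fun_prop

lemma isWeightSymbol_phiDeriv_rpow (hρ : IsMonotonicWeight ρ) (hc : 0 < c) (r : ℝ) :
    IsWeightSymbol ρ 0 (fun x => phiDeriv c x ^ r) := by
  apply isWeightSymbol_zero_of_hasTemperateGrowth ρ hρ.1
  have h1 : Function.HasTemperateGrowth (fun x : ℝ => x * c⁻¹) := by fun_prop
  have h2 := (Function.hasTemperateGrowth_one_add_norm_sq_rpow ℝ r).comp h1
  have h3 := (Function.HasTemperateGrowth.const ((c / 2) ^ r) (E := ℝ)).mul h2
  refine (congrArg Function.HasTemperateGrowth (funext fun x => ?_)).mpr h3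
  simp only [Pi.mul_apply, Function.comp_apply]
  rw [← Real.mul_rpow (by positivity) (by positivity)]
  congr 1
  unfold phiDeriv
  rw [Real.norm_eq_abs, sq_abs]
  field_simp

lemma isWeightSymbol_transWeight (hρ : IsMonotonicWeight ρ) (hc : 0 < c) (p : ℝ) :
    IsWeightSymbol ρ (1 / p) (transWeight c p ρ) := by
  have h := (hρ.isWeightSymbol_rpow (1 / p)).mul hρ.1 (isWeightSymbol_phiDeriv_rpow hρ hc (1 / p))
  rwa [add_zero] at h

lemma gTrans_eq (hc : 0 < c) {θ : ℝ} (hθ : θ ∈ Ioo 0 (2 * Real.pi)) (p : ℝ) (ρ : ℝ → ℝ)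
    (f : ℝ → ℂ) : gTrans c p ρ f θ = transWeight c p ρ (phi c θ) • f (phi c θ) := by
  rw [gTrans, transWeight, deriv_phi hc hθ, Complex.real_smul]
  push_cast
  ring

/-- The expansion of `(m D)^τ (w f)` in terms of a family `h` of derivatives of `f`. -/
noncomputable def transDeriv (c p : ℝ) (ρ : ℝ → ℝ) (h : ℕ → ℝ → ℂ) (τ : ℕ) (x : ℝ) : ℂ :=
  ∑ j ∈ Finset.range (τ + 1), transCoeff (phiDeriv c) (transWeight c p ρ) τ j x • h j x

lemma transDeriv_succ (c p : ℝ) (ρ : ℝ → ℝ) (h : ℕ → ℝ → ℂ) (τ : ℕ) (x : ℝ) :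
    transDeriv c p ρ h (τ + 1) x = phiDeriv c x • ∑ j ∈ Finset.range (τ + 1),
      (deriv (transCoeff (phiDeriv c) (transWeight c p ρ) τ j) x • h j x +
        transCoeff (phiDeriv c) (transWeight c p ρ) τ j x • h (j + 1) x) := by
  rw [transDeriv, Finset.sum_range_succ']
  simp only [transCoeff, mul_smul, add_smul, smul_add]
  -- The `j = 0` term rejoins the sum of differentiated coefficients, whose top term `j = τ + 1`
  -- vanishes.
  rw [Finset.sum_add_distrib, Finset.sum_add_distrib, smul_add, Finset.smul_sum, Finset.smul_sum,
    add_right_comm, ← Finset.sum_range_succ'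
      (fun j => phiDeriv c x • deriv (transCoeff (phiDeriv c) (transWeight c p ρ) τ j) x • h j x),
    Finset.sum_range_succ, transCoeff_eq_zero _ _ (Nat.lt_succ_self τ)]
  simp

lemma isWeakDeriv_transDeriv (hρ : IsMonotonicWeight ρ) (hc : 0 < c) (p : ℝ) {h : ℕ → ℝ → ℂ}
    (h0 : h 0 = f) (H : ∀ j ≤ α, IsWeakDeriv univ j f (h j)) (hτ : τ ≤ α) :
    IsWeakDeriv (Ioo 0 (2 * Real.pi)) τ (gTrans c p ρ f)
      (fun θ => transDeriv c p ρ h τ (phi c θ)) := by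
  have hsym := isWeightSymbol_transCoeff hρ.1 (isWeightSymbol_phiDeriv hρ c)
    (isWeightSymbol_transWeight hρ hc p)
  induction τ with
  | zero =>
    have hw := (isWeightSymbol_transWeight hρ hc p).1.continuous
    have hli : LocallyIntegrableOn (fun x => transWeight c p ρ x • f x) univ :=
      (H 0 hτ).1.continuousOn_smul isOpen_univ.isLocallyClosed hw.continuousOn
    have hg : (fun θ => transWeight c p ρ (phi c θ) • f (phi c θ))
        =ᵐ[volume.restrict (Ioo 0 (2 * Real.pi))] gTrans c p ρ f := by
      filter_upwards [ae_restrict_mem measurableSet_Ioo] with θ hθ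
      rw [gTrans_eq hc hθ]
    refine (isWeakDeriv_zero (locallyIntegrableOn_comp_phi hc hli)).congr_ae hg ?_
    exact Eventually.of_forall fun θ => by simp [transDeriv, transCoeff, h0]
  | succ τ ih =>
    have h1 := isWeakDeriv_one_sum (Finset.range (τ + 1)) isOpen_univ fun j hj =>
      (((H j (by have := Finset.mem_range.1 hj; omega)).one_of_succ
        (H (j + 1) (by have := Finset.mem_range.1 hj; omega))).smul_contDiff isOpen_univ
          (hsym τ j).1)
    have h2 := (ih (by omega)).trans_one (h1.comp_phi hc)
    simpa only [← transDeriv_succ] using h2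

lemma exists_norm_transDeriv_rpow_le (hρ : IsMonotonicWeight ρ) (hc : 0 < c) (hp : 1 ≤ p)
    (hpq : p < q) (τ : ℕ) :
    ∃ D : ℝ, 0 ≤ D ∧ ∀ (h : ℕ → ℝ → ℂ) (x : ℝ), ‖transDeriv c p ρ h τ x‖ ^ q ≤
      D * ∑ j ∈ Finset.range (τ + 1), ‖h j x‖ ^ q * ρ x := by
  have hq : 0 < q := by linarith
  have hsym := isWeightSymbol_transCoeff hρ.1 (isWeightSymbol_phiDeriv hρ c)
    (isWeightSymbol_transWeight hρ hc p)
  -- The strict inequality `p < q` makes `1 / q` an admissible exponent; its `q`-th power is exactly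
  -- one factor `ρ`.
  have hlt : 1 / q < 1 / p := one_div_lt_one_div_of_lt (by linarith) hpq
  choose C hC using fun j => (hsym τ j).2 0 (1 / q) hlt
  simp only [iteratedDeriv_zero] at hC
  have hC0 : ∀ j, 0 ≤ C j := fun j => nonneg_of_mul_nonneg_left
    ((abs_nonneg _).trans (hC j 0)) (Real.rpow_pos_of_pos (hρ.1 0) _)
  set B := ∑ j ∈ Finset.range (τ + 1), C j with hB
  have hB0 : 0 ≤ B := Finset.sum_nonneg fun j _ => hC0 j
  refine ⟨((τ + 1 : ℕ) : ℝ) ^ (q - 1) * B ^ q, by positivity, fun h x => ?_⟩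
  have hx := hρ.1 x
  have e1 : ‖transDeriv c p ρ h τ x‖ ≤
      ∑ j ∈ Finset.range (τ + 1), B * ρ x ^ (1 / q) * ‖h j x‖ := by
    refine (norm_sum_le _ _).trans (Finset.sum_le_sum fun j hj => ?_)
    rw [norm_smul, Real.norm_eq_abs]
    refine mul_le_mul_of_nonneg_right ((hC j x).trans ?_) (norm_nonneg _)
    have := Finset.single_le_sum (fun j _ => hC0 j) hj
    gcongr
  calc ‖transDeriv c p ρ h τ x‖ ^ q
      ≤ (∑ j ∈ Finset.range (τ + 1), B * ρ x ^ (1 / q) * ‖h j x‖) ^ q :=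
        Real.rpow_le_rpow (norm_nonneg _) e1 hq.le
    _ ≤ ((Finset.range (τ + 1)).card : ℝ) ^ (q - 1) *
        ∑ j ∈ Finset.range (τ + 1), (B * ρ x ^ (1 / q) * ‖h j x‖) ^ q :=
        Real.rpow_sum_le_const_mul_sum_rpow_of_nonneg _ (by linarith)
          fun j _ => by positivity
    _ = _ := by
      rw [Finset.card_range, mul_assoc, Finset.mul_sum (a := B ^ q)]
      congr 1
      refine Finset.sum_congr rfl fun j _ => ?_
      rw [Real.mul_rpow (by positivity) (norm_nonneg _), Real.mul_rpow hB0 (by positivity),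
        ← Real.rpow_mul hx.le, one_div_mul_cancel hq.ne', Real.rpow_one]
      ring

lemma MemSobolev.exists_family (hf : MemSobolev univ ρ α q f) :
    ∃ h : ℕ → ℝ → ℂ, h 0 = f ∧ ∀ j ≤ α, IsWeakDeriv univ j f (h j) ∧ MemLq univ ρ q (h j) ∧
      ∫ x, ‖h j x‖ ^ q * ρ x = ∫ x in univ, ‖weakDeriv univ j f x‖ ^ q * ρ x := by
  obtain ⟨hf0, hf⟩ := hf
  have key : ∀ j, ∃ h : ℝ → ℂ, (j = 0 → h = f) ∧
      (j ≤ α → IsWeakDeriv univ j f h ∧ MemLq univ ρ q h) := by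
    intro j
    rcases Nat.eq_zero_or_pos j with rfl | hj
    · obtain ⟨h, hh, -⟩ := hf 0 (Nat.zero_le α)
      exact ⟨f, fun _ => rfl, fun _ => ⟨isWeakDeriv_zero hh.1, hf0⟩⟩
    · by_cases hjα : j ≤ α
      · obtain ⟨h, hh⟩ := hf j hjα
        exact ⟨h, fun h => by omega, fun _ => hh⟩
      · exact ⟨0, fun h => by omega, fun h => absurd h hjα⟩
  choose h h0 h1 using key
  refine ⟨h, h0 0 rfl, fun j hj => ⟨(h1 j hj).1, (h1 j hj).2, ?_⟩⟩
  have e := (h1 j hj).1.ae_eq isOpen_univ (isWeakDeriv_weakDeriv (h1 j hj).1)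
  rw [← setIntegral_univ]
  exact integral_congr_ae (e.mono fun x hx => by simp only [hx])

/-- The bound is stated in `dx` rather than `dθ`: it is stronger, and the boundary values depend on
it. -/
lemma exists_transform (hρ : IsMonotonicWeight ρ) (hc : 0 < c) (hp : 1 ≤ p) (hpq : p < q) (τ : ℕ) :
    ∃ D : ℝ, 0 ≤ D ∧ ∀ α, τ ≤ α → ∀ f, MemSobolev univ ρ α q f → ∃ H : ℝ → ℂ,
      IsWeakDeriv (Ioo 0 (2 * Real.pi)) τ (gTrans c p ρ f) (fun θ => H (phi c θ)) ∧
      Integrable (fun x => ‖H x‖ ^ q) ∧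
      ∫ x, ‖H x‖ ^ q ≤ D * ∑ j ∈ Finset.range (α + 1),
        ∫ x in univ, ‖weakDeriv univ j f x‖ ^ q * ρ x := by
  obtain ⟨D, hD, hbound⟩ := exists_norm_transDeriv_rpow_le hρ hc hp hpq τ
  refine ⟨D, hD, fun α hα f hf => ?_⟩
  obtain ⟨h, h0, hh⟩ := hf.exists_family
  have hle : ∀ j ∈ Finset.range (τ + 1), j ≤ α := fun j hj => by
    have := Finset.mem_range.1 hj; omega
  have hint : ∀ j ∈ Finset.range (τ + 1), Integrable (fun x => ‖h j x‖ ^ q * ρ x) :=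
    fun j hj => by simpa using (hh j (hle j hj)).2.1.2
  have hsum : Integrable (fun x => D * ∑ j ∈ Finset.range (τ + 1), ‖h j x‖ ^ q * ρ x) :=
    (integrable_finsetSum _ hint).const_mul D
  have hsym := isWeightSymbol_transCoeff hρ.1 (isWeightSymbol_phiDeriv hρ c)
    (isWeightSymbol_transWeight hρ hc p)
  have hmeas : AEStronglyMeasurable (transDeriv c p ρ h τ) := by
    refine Finset.aestronglyMeasurable_fun_sum _ fun j hj => ?_
    have hm : AEStronglyMeasurable (h j) := by simpa using (hh j (hle j hj)).2.1.1
    exact (hsym τ j).1.continuous.aestronglyMeasurable.smul hm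
  have hH : Integrable (fun x => ‖transDeriv c p ρ h τ x‖ ^ q) := by
    refine hsum.mono' (hmeas.norm.aemeasurable.pow_const q).aestronglyMeasurable
      (Eventually.of_forall fun x => ?_)
    rw [Real.norm_of_nonneg (by positivity)]
    exact hbound h x
  refine ⟨transDeriv c p ρ h τ,
    isWeakDeriv_transDeriv hρ hc p h0 (fun j hj => (hh j hj).1) hα, hH, ?_⟩
  refine (integral_mono hH hsum (hbound h)).trans ?_
  rw [integral_const_mul, integral_finsetSum _ hint,
    Finset.sum_congr rfl fun j hj => (hh j (hle j hj)).2.2]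
  refine mul_le_mul_of_nonneg_left ?_ hD
  refine Finset.sum_le_sum_of_subset_of_nonneg (Finset.range_mono (by omega)) fun j _ _ => ?_
  exact integral_nonneg fun x => mul_nonneg (by positivity) (hρ.1 x).le

end Transform

/-! ### Return to the interval and boundary values. -/

section Boundary

variable {c q : ℝ}

lemma memLq_comp_phi (hc : 0 < c) {H : ℝ → ℂ}
    (hm : AEStronglyMeasurable (fun θ => H (phi c θ)) (volume.restrict (Ioo 0 (2 * Real.pi))))
    (hH : Integrable (fun x => ‖H x‖ ^ q)) :
    MemLq (Ioo 0 (2 * Real.pi)) (fun _ => 1) q (fun θ => H (phi c θ)) ∧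
      ∫ θ in Ioo 0 (2 * Real.pi), ‖H (phi c θ)‖ ^ q * 1 ≤ 2 / c * ∫ x, ‖H x‖ ^ q := by
  have h1 := ((integrableOn_comp_phi_iff hc fun x => ‖H x‖ ^ q).2 hH).const_mul (2 / c)
  have hle : ∀ θ, ‖H (phi c θ)‖ ^ q * 1 ≤
      2 / c * (phiDeriv c (phi c θ) • ‖H (phi c θ)‖ ^ q) := fun θ => by
    have h2 : 1 ≤ 2 / c * phiDeriv c (phi c θ) := by
      have := mul_le_mul_of_nonneg_left (le_phiDeriv hc (phi c θ)) (show 0 ≤ 2 / c by positivity)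
      rwa [div_mul_div_cancel₀ hc.ne', div_self two_ne_zero] at this
    rw [smul_eq_mul, ← mul_assoc, mul_comm]
    exact mul_le_mul_of_nonneg_right h2 (by positivity)
  have h3 : IntegrableOn (fun θ => ‖H (phi c θ)‖ ^ q * 1) (Ioo 0 (2 * Real.pi)) := by
    refine Integrable.mono' h1 ?_ (Eventually.of_forall fun θ => ?_)
    · exact ((hm.norm.aemeasurable.pow_const q).mul_const 1).aestronglyMeasurable
    · rw [Real.norm_of_nonneg (by positivity)]
      exact hle θ
  refine ⟨⟨hm, h3⟩, (integral_mono h3 h1 hle).trans_eq ?_⟩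
  rw [integral_const_mul]
  exact congrArg _ (integral_comp_phi hc fun x => ‖H x‖ ^ q)

lemma MemLq.congr_ae {U : Set ℝ} {w : ℝ → ℝ} {f g : ℝ → ℂ} (h : MemLq U w q f)
    (e : f =ᵐ[volume.restrict U] g) : MemLq U w q g :=
  ⟨h.1.congr e, h.2.congr (e.mono fun x hx => by simp only [hx])⟩

lemma MemLq.integrableOn {a b : ℝ} {g : ℝ → ℂ} (hq : 1 ≤ q)
    (h : MemLq (Ioo a b) (fun _ => 1) q g) : IntegrableOn g (Ioo a b) := by
  have h1 : IntegrableOn (fun _ => (1 : ℝ)) (Ioo a b) := integrableOn_const (by simp)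
  refine (h1.add h.2).mono' h.1 (Eventually.of_forall fun x => ?_)
  simp only [Pi.add_apply, mul_one]
  rcases le_total ‖g x‖ 1 with h | h
  · have : 0 ≤ ‖g x‖ ^ q := by positivity
    linarith
  · have := Real.rpow_le_rpow_of_exponent_le h hq
    rw [Real.rpow_one] at this
    linarith

/-- An integrable function cannot have a nonzero limit along a filter all of whose sets have
infinite measure. -/
lemma eq_zero_of_integrable_comp_phiInv (hq : 0 < q) {R : ℝ → ℂ}
    (hR : ContinuousOn R (Icc 0 (2 * Real.pi)))
    (hi : Integrable (fun x => ‖R (phiInv c x)‖ ^ q)) {l : Filter ℝ}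
    (hl : ∀ s ∈ l, volume s = ⊤) {e : ℝ} (he : e ∈ Icc 0 (2 * Real.pi))
    (ht : Tendsto (phiInv c) l (𝓝 e)) : R e = 0 := by
  have h1 : Tendsto (phiInv c) l (𝓝[Icc 0 (2 * Real.pi)] e) :=
    tendsto_nhdsWithin_iff.2 ⟨ht, Eventually.of_forall fun x =>
      Ioo_subset_Icc_self (phiInv_mem c x)⟩
  have h2 : Tendsto (fun x => ‖R (phiInv c x)‖ ^ q) l (𝓝 (‖R e‖ ^ q)) :=
    (((hR e he).tendsto.comp h1).norm).rpow_const (Or.inr hq.le)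
  have h3 := (hi.integrableAtFilter l).eq_zero_of_tendsto hl h2
  exact norm_eq_zero.1 ((Real.rpow_eq_zero (norm_nonneg _) hq.ne').1 h3)

lemma volume_eq_top_of_mem_atTop {s : Set ℝ} (hs : s ∈ (atTop : Filter ℝ)) : volume s = ⊤ := by
  obtain ⟨b, hb⟩ := mem_atTop_sets.1 hs
  rw [← top_le_iff, ← Real.volume_Ici (a := b)]
  exact measure_mono hb

lemma volume_eq_top_of_mem_atBot {s : Set ℝ} (hs : s ∈ (atBot : Filter ℝ)) : volume s = ⊤ := by
  obtain ⟨b, hb⟩ := mem_atBot_sets.1 hs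
  rw [← top_le_iff, ← Real.volume_Iic (a := b)]
  exact measure_mono hb

/-- A function on `(0, 2π)` with an integrable weak derivative, which is `q`-integrable in the
variable `x = phi c θ`, has a representative continuous on `[0, 2π]` vanishing at both endpoints. -/
lemma exists_continuousOn_representative (hc : 0 < c) (hq : 0 < q) {H g : ℝ → ℂ}
    (hg : IntegrableOn g (Ioo 0 (2 * Real.pi)))
    (hw : IsWeakDeriv (Ioo 0 (2 * Real.pi)) 1 (fun θ => H (phi c θ)) g)
    (hH : Integrable (fun x => ‖H x‖ ^ q)) :
    ∃ R : ℝ → ℂ, (fun θ => H (phi c θ)) =ᵐ[volume.restrict (Ioo 0 (2 * Real.pi))] R ∧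
      ContinuousOn R (Icc 0 (2 * Real.pi)) ∧ R 0 = 0 ∧ R (2 * Real.pi) = 0 := by
  have hπ := Real.two_pi_pos
  obtain ⟨C, hC⟩ := hw.ae_eq_primitive hπ hg
  set R : ℝ → ℂ := fun x => C + ∫ t in (0 : ℝ)..x, g t with hRdef
  have hgc : IntegrableOn g (uIcc 0 (2 * Real.pi)) := by
    rw [uIcc_of_le hπ.le, integrableOn_Icc_iff_integrableOn_Ioo]; exact hg
  have hR : ContinuousOn R (Icc 0 (2 * Real.pi)) := by
    have h := intervalIntegral.continuousOn_primitive_interval hgc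
    rw [uIcc_of_le hπ.le] at h
    exact continuousOn_const.add h
  have hi : Integrable (fun x => ‖R (phiInv c x)‖ ^ q) := by
    rw [← integrableOn_comp_phi_iff hc] at hH ⊢
    refine hH.congr ?_
    filter_upwards [hC, ae_restrict_mem measurableSet_Ioo] with θ h1 h2
    rw [phiInv_phi hc h2, h1]
  exact ⟨R, hC, hR,
    eq_zero_of_integrable_comp_phiInv hq hR hi (fun _ => volume_eq_top_of_mem_atBot)
      ⟨le_rfl, hπ.le⟩ (tendsto_phiInv_atBot hc),
    eq_zero_of_integrable_comp_phiInv hq hR hi (fun _ => volume_eq_top_of_mem_atTop)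
      ⟨hπ.le, le_rfl⟩ (tendsto_phiInv_atTop hc)⟩

end Boundary

end MoebiusSobolev

/-! ### Assembly of the theorem. -/

theorem mainTheorem6 (c : ℝ) (hc : 0 < c) (ρ : 𝓢(ℝ, ℝ))
    (hρ : MoebiusSobolev.IsMonotonicWeight ρ) (p q : ℝ) (hp : 1 ≤ p) (hpq : p < q) :
    -- the norm bound; the constant depends on `c, ρ, p, q, τ` only
    (∀ τ : ℕ, ∃ C : ℝ, 0 < C ∧ ∀ α : ℕ, 1 ≤ α → τ ≤ α → ∀ f : ℝ → ℂ,
      MoebiusSobolev.MemSobolev univ ρ α q f →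
        MoebiusSobolev.IsWeakDeriv (Ioo 0 (2 * Real.pi)) τ (MoebiusSobolev.gTrans c p ρ f)
          (MoebiusSobolev.weakDeriv (Ioo 0 (2 * Real.pi)) τ (MoebiusSobolev.gTrans c p ρ f)) ∧
        MoebiusSobolev.MemLq (Ioo 0 (2 * Real.pi)) (fun _ => 1) q
          (MoebiusSobolev.weakDeriv (Ioo 0 (2 * Real.pi)) τ (MoebiusSobolev.gTrans c p ρ f)) ∧
        MoebiusSobolev.lqNorm (Ioo 0 (2 * Real.pi)) (fun _ => 1) q
          (MoebiusSobolev.weakDeriv (Ioo 0 (2 * Real.pi)) τ (MoebiusSobolev.gTrans c p ρ f))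
          ≤ C * MoebiusSobolev.sobolevNorm univ ρ α q f) ∧
    ∀ α : ℕ, 1 ≤ α → ∀ f : ℝ → ℂ, MoebiusSobolev.MemSobolev univ ρ α q f →
      -- the continuous representative of each derivative of order `< α` exists, and vanishes
      -- in the limit at both endpoints
      (∀ τ < α,
        (∃ h : ℝ → ℂ,
          MoebiusSobolev.IsWeakDeriv (Ioo 0 (2 * Real.pi)) τ (MoebiusSobolev.gTrans c p ρ f) h ∧
          ContinuousOn h (Ioo 0 (2 * Real.pi))) ∧
        ∀ h : ℝ → ℂ,
          MoebiusSobolev.IsWeakDeriv (Ioo 0 (2 * Real.pi)) τ (MoebiusSobolev.gTrans c p ρ f) h →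
          ContinuousOn h (Ioo 0 (2 * Real.pi)) →
          Tendsto h (𝓝[>] 0) (𝓝 0) ∧ Tendsto h (𝓝[<] (2 * Real.pi)) (𝓝 0)) ∧
      MoebiusSobolev.MemSobolevPer α q (MoebiusSobolev.gTrans c p ρ f) := by
  have hq0 : 0 < q := by linarith
  have hq1 : 1 ≤ q := by linarith
  refine ⟨fun τ => ?_, fun α hα f hf => ?_⟩
  · obtain ⟨D, hD, hT⟩ := MoebiusSobolev.exists_transform hρ hc hp hpq τ
    -- The summand `1` ensures strict positivity, as `D` is only known to be nonnegative.
    refine ⟨(2 / c * D) ^ (1 / q) + 1, by positivity, fun α _ hτ f hf => ?_⟩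
    obtain ⟨H, hw, hi, hle⟩ := hT α hτ f hf
    have hw' := MoebiusSobolev.isWeakDeriv_weakDeriv hw
    have hae := hw.ae_eq isOpen_Ioo hw'
    obtain ⟨hm, hb⟩ := MoebiusSobolev.memLq_comp_phi hc
      (hw.2.1.aestronglyMeasurable) hi
    refine ⟨hw', hm.congr_ae hae, ?_⟩
    have hS : 0 ≤ ∑ j ∈ Finset.range (α + 1),
        ∫ x in univ, ‖MoebiusSobolev.weakDeriv univ j f x‖ ^ q * ρ x :=
      Finset.sum_nonneg fun j _ => integral_nonneg fun x =>
        mul_nonneg (by positivity) (hρ.1 x).le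
    have heq : ∫ θ in Ioo 0 (2 * Real.pi), ‖MoebiusSobolev.weakDeriv (Ioo 0 (2 * Real.pi)) τ
        (MoebiusSobolev.gTrans c p ρ f) θ‖ ^ q * 1 =
        ∫ θ in Ioo 0 (2 * Real.pi), ‖H (MoebiusSobolev.phi c θ)‖ ^ q * 1 :=
      integral_congr_ae (hae.mono fun θ h => by simp only [h])
    rw [MoebiusSobolev.lqNorm, MoebiusSobolev.sobolevNorm, heq]
    refine (Real.rpow_le_rpow (integral_nonneg fun x => by positivity)
      (hb.trans (mul_le_mul_of_nonneg_left hle (by positivity))) (by positivity)).trans ?_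
    rw [← mul_assoc, Real.mul_rpow (by positivity) hS]
    exact mul_le_mul_of_nonneg_right (by linarith) (by positivity)
  · have hrep : ∀ τ < α, ∃ R : ℝ → ℂ,
        MoebiusSobolev.IsWeakDeriv (Ioo 0 (2 * Real.pi)) τ (MoebiusSobolev.gTrans c p ρ f) R ∧
        ContinuousOn R (Icc 0 (2 * Real.pi)) ∧ R 0 = 0 ∧ R (2 * Real.pi) = 0 := by
      intro τ hτ
      obtain ⟨_, -, hT⟩ := MoebiusSobolev.exists_transform hρ hc hp hpq τ
      -- Order `τ + 1` is available because `τ < α`; it supplies the integrable derivative behind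
      -- the continuous representative.
      obtain ⟨_, -, hT'⟩ := MoebiusSobolev.exists_transform hρ hc hp hpq (τ + 1)
      obtain ⟨H, hw, hi, -⟩ := hT α hτ.le f hf
      obtain ⟨H', hw', hi', -⟩ := hT' α hτ f hf
      have hm := (MoebiusSobolev.memLq_comp_phi hc hw'.2.1.aestronglyMeasurable hi').1
      obtain ⟨R, hR, hRc, hR0, hR1⟩ := MoebiusSobolev.exists_continuousOn_representative hc hq0
        (hm.integrableOn hq1) (hw.one_of_succ hw') hi
      exact ⟨R, hw.congr_ae EventuallyEq.rfl hR, hRc, hR0, hR1⟩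
    refine ⟨fun τ hτ => ?_, ⟨?_, fun τ hτ => ?_⟩, fun τ hτ => ?_⟩
    · obtain ⟨R, hw, hRc, hR0, hR1⟩ := hrep τ hτ
      refine ⟨⟨R, hw, hRc.mono Ioo_subset_Icc_self⟩, fun h hh hhc => ?_⟩
      have hae := hh.ae_eq isOpen_Ioo hw
      have heq : EqOn h R (Ioo 0 (2 * Real.pi)) :=
        Measure.eqOn_open_of_ae_eq hae isOpen_Ioo hhc (hRc.mono Ioo_subset_Icc_self)
      have hπ := Real.two_pi_pos
      have lim : ∀ e ∈ Icc 0 (2 * Real.pi), R e = 0 →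
          Tendsto h (𝓝[Ioo 0 (2 * Real.pi)] e) (𝓝 0) := fun e he h0 => by
        have h1 := ((hRc e he).mono Ioo_subset_Icc_self).tendsto
        rw [h0] at h1
        exact h1.congr' (eventually_nhdsWithin_of_forall fun x hx => (heq hx).symm)
      rw [← nhdsWithin_Ioo_eq_nhdsGT hπ, ← nhdsWithin_Ioo_eq_nhdsLT hπ]
      exact ⟨lim _ ⟨le_rfl, hπ.le⟩ hR0, lim _ ⟨hπ.le, le_rfl⟩ hR1⟩
    · obtain ⟨_, -, hT⟩ := MoebiusSobolev.exists_transform hρ hc hp hpq 0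
      obtain ⟨H, hw, hi, -⟩ := hT α (Nat.zero_le α) f hf
      exact (MoebiusSobolev.memLq_comp_phi hc hw.2.1.aestronglyMeasurable hi).1.congr_ae
        (hw.ae_eq isOpen_Ioo (MoebiusSobolev.isWeakDeriv_zero hw.1))
    · obtain ⟨_, -, hT⟩ := MoebiusSobolev.exists_transform hρ hc hp hpq τ
      obtain ⟨H, hw, hi, -⟩ := hT α hτ f hf
      exact ⟨_, hw, (MoebiusSobolev.memLq_comp_phi hc hw.2.1.aestronglyMeasurable hi).1⟩
    · obtain ⟨R, hw, hRc, hR0, hR1⟩ := hrep τ hτ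
      exact ⟨R, hw, hRc, hR0.trans hR1.symm⟩
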